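/- For a topological space $Y$, let $w(Y)$ be the minimal cardinality of a basis of $Y$, and let $d(Y)$ be the minimal cardinality of a dense subset of $Y$. For a point $x\in Y$, let $\mathrm{ld}(x)$ be the minimal density of a neighborhood of $x$. For a partially ordered set $P$, let $\mathrm{cof}(P)$ be the minimal cardinality of a cofinal subset of $P$, that is, of a subset $C\subseteq P$ such that every $p\in P$ satisfies $p\le c$ for some $c\in C$. Let $\mathfrak{d}:=\mathrm{cof}(\mathbb{N}^{\mathbb{N}},\le)$, where $f\le g$ means $f(n)\le g(n)$ for all $n$. For a cardinal number $\kappa$, let $[\kappa]^{\aleph_0}$ be the family of all countably infinite subsets of $\kappa$, ordered by inclusion (for finite $\kappa$ this family is empty and its cofinality is $0$). For a topological group $G$, let $C(X,G)$ be the set of continuous functions from $X$ to $G$ with the compact-open topology. Let $X$ be a complete metric space that is neither discrete nor compact, and let $G$ be a second countable topological group containing an arc, that is, a subspace homeomorphic to the unit interval $[0,1]$. 1. If $X$ is locally compact, then $w(C(X,G))=d(X)$. 2. If $X$ is not locally compact, then $$w(C(X,G))=d(X)\cdot\mathfrak{d}\cdot\sup_{x\in X}\mathrm{cof}\bigl([\mathrm{ld}(x)]^{\aleph_0}\bigr).$$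 -/

import Mathlib

universe u v

namespace CompactOpenWeight

noncomputable section

/-- The weight of a topological space: the minimal cardinality of a basis. -/
def weight (X : Type u) [TopologicalSpace X] : Cardinal.{u} :=
  ⨅ B : {B : Set (Set X) // TopologicalSpace.IsTopologicalBasis B}, Cardinal.mk B.1

/-- The density of a topological space: the minimal cardinality of a dense subset. -/
def density (X : Type u) [TopologicalSpace X] : Cardinal.{u} :=
  ⨅ D : {D : Set X // Dense D}, Cardinal.mk D.1

/-- The local density of a point: the minimal density of a neighborhood of the point. -/
def localDensity {X : Type u} [TopologicalSpace X] (x : X) : Cardinal.{u} :=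
  ⨅ U : {U : Set X // U ∈ nhds x}, density U.1

/-- The countably infinite subsets of a set of cardinality `κ`, ordered by inclusion. -/
abbrev CountablyInfiniteSubsets (κ : Cardinal.{u}) : Type u :=
  {s : Set κ.out // Cardinal.mk s = Cardinal.aleph0}

/-- The dominating number: the cofinality of `ℕ → ℕ` with the pointwise (everywhere) order. -/
def dominatingNumber : Cardinal.{0} := Order.cof (ℕ → ℕ)

/-- A space contains an arc if it has a subspace homeomorphic to the unit interval. -/
def ContainsArc (G : Type v) [TopologicalSpace G] : Prop :=
  ∃ γ : unitInterval → G, Topology.IsEmbedding γ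

end

end CompactOpenWeight

namespace CompactOpenWeight

open Set Filter Topology TopologicalSpace Cardinal
open scoped unitInterval

/-! Both formulas come from `weight_continuousMap_eq`: for noncompact `X` the weight of `C(X, G)` is
the cofinality of the compact subsets of `X`. A cofinal family of compacts generates the topology
through second countable spaces `C(K, G)`; conversely, a neighborhood of a constant map on the arc
controls functions only on a compact set.

Lower bounds on this cofinality are the density and, by Tukey reductions, the other two factors:
finite pieces of separated sets in shrinking balls, together with the center, form a compact set,
and any compact set meets each separated set in a finite set. For the upper bound,
`cof_compacts_le_of_local` glues local estimates by finite unions;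
`exists_compacts_covering_of_subset_closure` supplies them, since by completeness a compact set is
dominated by one coded by a countable set of centers and a function `ℕ → ℕ`. -/

/-! ### Weight of `C(X, G)` as the cofinality of compact sets -/

theorem weight_le_of_eq_generateFrom {Y : Type u} {ι : Type v} [t : TopologicalSpace Y]
    [Infinite ι] (f : ι → Set Y) (h : t = generateFrom (range f)) :
    lift.{v} (weight Y) ≤ lift.{u} #ι := by
  have hb := isTopologicalBasis_of_subbasis h
  have hle : weight Y ≤ #((fun s => ⋂₀ s) '' {s : Set (Set Y) | s.Finite ∧ s ⊆ range f}) :=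
    ciInf_le' (fun B : {B : Set (Set Y) // IsTopologicalBasis B} => #B.1) ⟨_, hb⟩
  have hsub : ((fun s => ⋂₀ s) '' {s : Set (Set Y) | s.Finite ∧ s ⊆ range f}) ⊆
      range fun F : Finset ι => ⋂ i ∈ F, f i := by
    rintro _ ⟨s, ⟨hs, hsf⟩, rfl⟩
    choose! g hg using hsf
    classical
    refine ⟨hs.toFinset.image g, ?_⟩
    ext y
    simp only [Finset.mem_image, Finite.mem_toFinset, mem_iInter, mem_sInter]
    exact ⟨fun h a ha => hg ha ▸ h _ ⟨a, ha, rfl⟩, by rintro h _ ⟨a, ha, rfl⟩; rw [hg ha]; exact h a ha⟩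
  calc lift.{v} (weight Y) ≤ lift.{v} #(range fun F : Finset ι => ⋂ i ∈ F, f i) :=
        lift_le.2 (hle.trans (mk_le_mk_of_subset hsub))
    _ ≤ lift.{u} #(Finset ι) := mk_range_le_lift
    _ = lift.{u} #ι := by rw [mk_finset_of_infinite]

theorem exists_basis_mk_eq_weight (Y : Type u) [TopologicalSpace Y] :
    ∃ B : Set (Set Y), IsTopologicalBasis B ∧ #B = weight Y := by
  have : Nonempty {B : Set (Set Y) // IsTopologicalBasis B} :=
    ⟨⟨_, isTopologicalBasis_opens⟩⟩
  obtain ⟨B, hB⟩ := ciInf_mem fun B : {B : Set (Set Y) // IsTopologicalBasis B} => #B.1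
  exact ⟨B.1, B.2, hB⟩

theorem exists_seq_generateFrom (Y : Type u) [t : TopologicalSpace Y]
    [SecondCountableTopology Y] : ∃ e : ℕ → Set Y, t = generateFrom (range e) := by
  obtain ⟨b, hb, -, hbt⟩ := exists_countable_basis Y
  -- Inserting `univ` makes the family nonempty, so a sequence can enumerate it.
  have hins : t = generateFrom (insert Set.univ b) := by
    rw [generateFrom_insert_univ, ← hbt.eq_generateFrom]
  obtain ⟨e, he⟩ := (hb.insert Set.univ).exists_eq_range (insert_nonempty _ _)
  exact ⟨e, he ▸ hins⟩

theorem compactOpen_eq_iInf_of_isCofinal {X : Type u} {G : Type v} [TopologicalSpace X]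
    [TopologicalSpace G] {S : Set (Compacts X)} (hS : IsCofinal S) :
    (ContinuousMap.compactOpen : TopologicalSpace C(X, G)) =
      ⨅ K : S, .induced (ContinuousMap.restrict (K.1 : Set X)) ContinuousMap.compactOpen := by
  refine le_antisymm (le_iInf fun K => ContinuousMap.compactOpen_le_induced _) ?_
  rw [ContinuousMap.compactOpen_eq_iInf_induced]
  refine le_iInf₂ fun K hK => ?_
  obtain ⟨L, hL, hKL⟩ := hS ⟨K, hK⟩
  refine (iInf_le _ ⟨L, hL⟩).trans ?_
  have hKL' : K ⊆ (L : Set X) := hKL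
  have hcont : Continuous fun f : C((L : Set X), G) =>
      f.comp ⟨Set.inclusion hKL', continuous_inclusion hKL'⟩ :=
    ContinuousMap.continuous_precomp _
  have := induced_mono (g := ContinuousMap.restrict (L : Set X) (β := G)) hcont.le_induced
  rw [induced_compose] at this
  exact this

/-- The minimal size of a cofinal family of compact sets bounds the weight of `C(X, G)`. -/
theorem weight_continuousMap_le {X : Type u} {G : Type v} [MetricSpace X]
    [TopologicalSpace G] [SecondCountableTopology G] (hX : ℵ₀ ≤ Order.cof (Compacts X)) :
    weight C(X, G) ≤ lift.{v} (Order.cof (Compacts X)) := by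
  obtain ⟨S, hS, hScard⟩ := Order.exists_cof_eq (Compacts X)
  have hinf : Infinite S := infinite_iff.2 (hScard ▸ hX)
  have hcpt (K : S) : CompactSpace (K.1 : Set X) := isCompact_iff_compactSpace.1 K.1.isCompact
  choose e he using fun K : S => exists_seq_generateFrom C((K.1 : Set X), G)
  have hgen : (ContinuousMap.compactOpen : TopologicalSpace C(X, G)) =
      generateFrom (range fun p : S × ℕ =>
        ContinuousMap.restrict (p.1.1 : Set X) ⁻¹' e p.1 p.2) := by
    rw [compactOpen_eq_iInf_of_isCofinal hS]
    have : (range fun p : S × ℕ => ContinuousMap.restrict (p.1.1 : Set X) ⁻¹' e p.1 p.2) =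
        ⋃ K : S, preimage (ContinuousMap.restrict (K.1 : Set X)) '' range (e K) := by
      ext s; simp
    rw [this, generateFrom_iUnion]
    refine iInf_congr fun K => ?_
    rw [← induced_generateFrom_eq, ← he K]
  have := weight_le_of_eq_generateFrom _ hgen
  have hcard : #(S × ℕ) = Order.cof (Compacts X) := by
    rw [← hScard]; simp
  rw [hcard] at this
  rwa [lift_umax.{u, v}, lift_id'.{u, v}] at this

theorem aleph0_le_cof_compacts {X : Type u} [TopologicalSpace X] (hX : ¬ CompactSpace X) :
    ℵ₀ ≤ Order.cof (Compacts X) := by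
  rw [Order.le_cof_iff]
  intro S hS
  by_contra! hlt
  have hfin : S.Finite := lt_aleph0_iff_set_finite.1 hlt
  refine hX ⟨?_⟩
  have : (univ : Set X) = ⋃ K ∈ S, (K : Set X) := by
    symm
    refine eq_univ_of_forall fun x => ?_
    obtain ⟨K, hK, hxK⟩ := hS ⟨{x}, isCompact_singleton⟩
    exact mem_biUnion hK (hxK (mem_singleton x))
  rw [this]
  exact hfin.isCompact_biUnion fun K _ => K.isCompact

/-- Each basic neighborhood `b` of the constant map `P z` contains `P f` for all `f` vanishing on
some compact `κ b`. These `κ b` are cofinal: if `b` forces `f < 1` on `K`, a Urysohn function that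
is `0` on `κ b` and `1` at a point of `K` outside `κ b` gives a contradiction. -/
theorem cof_compacts_le_weight {X : Type u} {G : Type v} [MetricSpace X] [TopologicalSpace G]
    (harc : ContainsArc G) :
    lift.{v} (Order.cof (Compacts X)) ≤ weight C(X, G) := by
  obtain ⟨γ, hγ⟩ := harc
  obtain ⟨B, hB, hBcard⟩ := exists_basis_mk_eq_weight C(X, G)
  let P : C(X, I) → C(X, G) := ContinuousMap.comp ⟨γ, hγ.continuous⟩
  have hP : IsInducing P := ContinuousMap.isInducing_postcomp ⟨γ, hγ.continuous⟩ hγ.isInducing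
  let z : C(X, I) := ContinuousMap.const X 0
  have key (b : {b : Set C(X, G) // b ∈ B ∧ P z ∈ b}) :
      ∃ K : Compacts X, ∀ f : C(X, I), (∀ x ∈ K, f x = 0) → P f ∈ b.1 := by
    have hb : P ⁻¹' b.1 ∈ 𝓝 z :=
      hP.continuous.continuousAt.preimage_mem_nhds ((hB.isOpen b.2.1).mem_nhds b.2.2)
    rw [UniformSpace.mem_nhds_iff] at hb
    obtain ⟨V, hV, hVb⟩ := hb
    obtain ⟨⟨K, W⟩, ⟨hK, hW⟩, hKW⟩ :=
      ContinuousMap.hasBasis_compactConvergenceUniformity.mem_iff.1 hV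
    refine ⟨⟨K, hK⟩, fun f hf => hVb (hKW fun x hx => ?_)⟩
    have : f x = 0 := hf x hx
    simpa [z, this] using refl_mem_uniformity hW
  choose κ hκ using key
  have hcof : IsCofinal (range κ) := by
    intro K
    have hO : IsOpen {f : C(X, I) | MapsTo f K {t : I | (t : ℝ) < 1}} :=
      ContinuousMap.isOpen_setOfPred_mapsTo K.isCompact
        (isOpen_lt continuous_subtype_val continuous_const)
    obtain ⟨O, hOopen, hOeq⟩ := hP.isOpen_iff.1 hO
    have hz : P z ∈ O := by
      have : z ∈ P ⁻¹' O := by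
        rw [hOeq]; intro x _; simp [z]
      exact this
    obtain ⟨b, hbB, hzb, hbO⟩ := hB.exists_subset_of_mem_open hz hOopen
    refine ⟨_, ⟨⟨b, hbB, hzb⟩, rfl⟩, ?_⟩
    intro x hxK
    by_contra hx
    obtain ⟨f, hf0, hf1, hfI⟩ := exists_continuous_zero_one_of_isClosed
      (κ ⟨b, hbB, hzb⟩).isCompact.isClosed (isClosed_singleton (x := x))
      (disjoint_singleton_right.2 hx)
    let g : C(X, I) := ⟨fun x => ⟨f x, hfI x⟩, by fun_prop⟩
    have hg : g ∈ P ⁻¹' O := hbO (hκ ⟨b, hbB, hzb⟩ g fun y hy => Subtype.ext (hf0 hy))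
    rw [hOeq] at hg
    have h1 : f x < 1 := hg hxK
    rw [hf1 (mem_singleton x)] at h1
    exact lt_irrefl _ h1
  have h1 : lift.{max u v} (Order.cof (Compacts X)) ≤
      lift.{u} #{b : Set C(X, G) // b ∈ B ∧ P z ∈ b} :=
    (lift_le.2 (Order.cof_le hcof)).trans mk_range_le_lift
  have h2 : #{b : Set C(X, G) // b ∈ B ∧ P z ∈ b} ≤ #B := mk_le_mk_of_subset fun b hb => hb.1
  rw [hBcard] at h2
  have h3 := h1.trans (lift_le.2 h2)
  rwa [lift_umax.{u, v}, lift_id'.{u, v}] at h3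

theorem weight_continuousMap_eq {X : Type u} {G : Type v} [MetricSpace X] [TopologicalSpace G]
    [SecondCountableTopology G] (hX : ¬ CompactSpace X) (harc : ContainsArc G) :
    weight C(X, G) = lift.{v} (Order.cof (Compacts X)) :=
  le_antisymm (weight_continuousMap_le (aleph0_le_cof_compacts hX)) (cof_compacts_le_weight harc)

/-! ### Tukey reductions, density and local density -/

theorem lift_cof_le_of_tukey {P : Type u} {Q : Type v} [Preorder P] [Preorder Q]
    (φ : P → Q) (ψ : Q → P) (h : ∀ p q, φ p ≤ q → p ≤ ψ q) :
    lift.{v} (Order.cof P) ≤ lift.{u} (Order.cof Q) := by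
  obtain ⟨S, hS, hcard⟩ := Order.exists_cof_eq Q
  have hcof : IsCofinal (ψ '' S) := fun p => by
    obtain ⟨q, hq, hpq⟩ := hS (φ p)
    exact ⟨ψ q, mem_image_of_mem ψ hq, h p q hpq⟩
  rw [← hcard]
  exact (lift_le.2 (Order.cof_le hcof)).trans mk_image_le_lift

theorem exists_dense_mk_eq_density (X : Type u) [TopologicalSpace X] :
    ∃ D : Set X, Dense D ∧ #D = density X := by
  have : Nonempty {D : Set X // Dense D} := ⟨⟨_, dense_univ⟩⟩
  obtain ⟨D, hD⟩ := ciInf_mem fun D : {D : Set X // Dense D} => #D.1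
  exact ⟨D.1, D.2, hD⟩

theorem density_le {X : Type u} [TopologicalSpace X] {D : Set X} (hD : Dense D) :
    density X ≤ #D :=
  ciInf_le' (fun D : {D : Set X // Dense D} => #D.1) ⟨D, hD⟩

theorem localDensity_le_of_subset_closure {X : Type u} [PseudoMetricSpace X] {x : X} {r : ℝ}
    (hr : 0 < r) {E : Set X} (hE : E ⊆ Metric.ball x r) (hcl : Metric.ball x r ⊆ closure E) :
    localDensity x ≤ #E := by
  have h1 : localDensity x ≤ density (Metric.ball x r) :=
    ciInf_le' (fun U : {U : Set X // U ∈ 𝓝 x} => density U.1) ⟨_, Metric.ball_mem_nhds x hr⟩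
  have h2 : Dense ((↑) ⁻¹' E : Set (Metric.ball x r)) := by
    rw [Subtype.dense_iff, Subtype.image_preimage_coe, inter_eq_right.2 hE]
    exact hcl
  exact h1.trans ((density_le h2).trans (mk_preimage_of_injective _ _ Subtype.val_injective))

theorem exists_nhds_subset_closure_mk_eq_localDensity {X : Type u} [TopologicalSpace X] (x : X) :
    ∃ U ∈ 𝓝 x, ∃ D : Set X, U ⊆ closure D ∧ #D = localDensity x := by
  have : Nonempty {U : Set X // U ∈ 𝓝 x} := ⟨⟨_, univ_mem⟩⟩
  obtain ⟨U, hU⟩ := ciInf_mem fun U : {U : Set X // U ∈ 𝓝 x} => density U.1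
  obtain ⟨D, hD, hcard⟩ := exists_dense_mk_eq_density U.1
  refine ⟨U.1, U.2, (↑) '' D, Subtype.dense_iff.1 hD, ?_⟩
  rw [mk_image_eq Subtype.val_injective, hcard]
  exact hU

theorem aleph0_le_density {X : Type u} [MetricSpace X] (hX : ¬ CompactSpace X) :
    ℵ₀ ≤ density X := by
  obtain ⟨D, hD, hcard⟩ := exists_dense_mk_eq_density X
  by_contra! hlt
  rw [← hcard, lt_aleph0_iff_set_finite] at hlt
  refine hX ⟨?_⟩
  rw [← hD.closure_eq, hlt.isClosed.closure_eq]
  exact hlt.isCompact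

/-- Compact sets are separable, and a cofinal family of them covers `X`. -/
theorem density_le_cof_compacts {X : Type u} [MetricSpace X] (hX : ¬ CompactSpace X) :
    density X ≤ Order.cof (Compacts X) := by
  obtain ⟨S, hS, hcard⟩ := Order.exists_cof_eq (Compacts X)
  have hinf : ℵ₀ ≤ Order.cof (Compacts X) := aleph0_le_cof_compacts hX
  choose c hc hKc using fun K : S => K.1.isCompact.isSeparable
  have hdense : Dense (⋃ K : S, c K) := fun x => by
    obtain ⟨K, hK, hxK⟩ := hS ⟨{x}, isCompact_singleton⟩
    exact closure_mono (subset_iUnion c ⟨K, hK⟩) (hKc ⟨K, hK⟩ (hxK (mem_singleton x)))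
  refine (density_le hdense).trans ((mk_iUnion_le c).trans ?_)
  refine mul_le_of_le hinf hcard.le (ciSup_le' fun K => ?_)
  exact (le_aleph0_iff_set_countable.2 (hc K)).trans hinf

/-! ### Separated sets and lower bounds -/

theorem exists_maximal_separated {X : Type u} [PseudoMetricSpace X] (A : Set X) {ε : ℝ}
    (hε : 0 < ε) :
    ∃ E ⊆ A, (∀ a ∈ E, ∀ b ∈ E, a ≠ b → ε ≤ dist a b) ∧ A ⊆ ⋃ e ∈ E, Metric.ball e ε := by
  obtain ⟨E, hE⟩ := zorn_subset {E | E ⊆ A ∧ E.Pairwise fun a b => ε ≤ dist a b} (by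
    intro c hc hchain
    refine ⟨⋃₀ c, ⟨sUnion_subset fun s hs => (hc hs).1, ?_⟩, fun s hs => subset_sUnion_of_mem hs⟩
    exact (pairwise_sUnion hchain.directedOn).2 fun s hs => (hc hs).2)
  refine ⟨E, hE.prop.1, fun a ha b hb hab => hE.prop.2 ha hb hab, fun y hy => ?_⟩
  by_contra hyE
  simp only [mem_iUnion, Metric.mem_ball, exists_prop, not_exists, not_and, not_lt] at hyE
  have hins : insert y E ∈ {E | E ⊆ A ∧ E.Pairwise fun a b => ε ≤ dist a b} :=
    ⟨insert_subset hy hE.prop.1, hE.prop.2.insert fun b hb _ =>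
      ⟨hyE b hb, dist_comm y b ▸ hyE b hb⟩⟩
  have hyE' : y ∈ E := hE.le_of_ge hins (subset_insert y E) (mem_insert y E)
  have := hyE y hyE'
  rw [dist_self] at this
  exact this.not_gt hε

theorem finite_preimage_of_separated {X : Type u} [PseudoMetricSpace X] {α : Type v} {K : Set X}
    (hK : IsCompact K) {j : α → X} {ε : ℝ} (hε : 0 < ε)
    (hj : ∀ a b, a ≠ b → ε ≤ dist (j a) (j b)) : (j ⁻¹' K).Finite := by
  obtain ⟨t, -, ht, hKt⟩ := hK.finite_cover_balls (half_pos hε)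
  have hcov (a : α) (ha : a ∈ j ⁻¹' K) : ∃ y ∈ t, dist (j a) y < ε / 2 := by
    simpa using hKt ha
  choose y hyt hy using hcov
  have := ht.to_subtype
  refine Finite.of_injective (fun a : j ⁻¹' K => (⟨y a a.2, hyt a a.2⟩ : t)) fun a b hab => ?_
  by_contra hne
  have h1 := hy a a.2
  have h2 := hy b b.2
  rw [← show y a a.2 = y b b.2 from Subtype.mk.inj hab, dist_comm] at h2
  linarith [hj a b fun h => hne (Subtype.ext h), dist_triangle (j a) (y a a.2) (j b)]

/-- An ultrafilter on this set that does not converge to `x` avoids some ball around `x`, hence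
lives on the finitely many points of the first few `F n`. -/
theorem isCompact_insert_iUnion_of_finite {X : Type u} [PseudoMetricSpace X] {x : X}
    {F : ℕ → Set X} (hfin : ∀ n, (F n).Finite)
    (hball : ∀ n, F n ⊆ Metric.ball x (1 / (n + 1))) : IsCompact (insert x (⋃ n, F n)) := by
  rw [isCompact_iff_ultrafilter_le_nhds]
  intro f hf
  rw [le_principal_iff] at hf
  by_cases hx : (f : Filter X) ≤ 𝓝 x
  · exact ⟨x, mem_insert _ _, hx⟩
  obtain ⟨r, hr, hrf⟩ : ∃ r > 0, Metric.ball x r ∉ f := by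
    by_contra! h
    exact hx (Metric.nhds_basis_ball.ge_iff.2 h)
  obtain ⟨N, hN⟩ := exists_nat_one_div_lt hr
  have hcompl : (Metric.ball x r)ᶜ ∈ f := Ultrafilter.compl_mem_iff_notMem.2 hrf
  have hfinite : (⋃ n ∈ Iio N, F n).Finite := (finite_Iio N).biUnion fun n _ => hfin n
  have hmem : (⋃ n ∈ Iio N, F n) ∈ f := by
    filter_upwards [hf, hcompl] with y hy hyr
    rcases hy with rfl | hy
    · exact absurd (Metric.mem_ball_self hr) hyr
    obtain ⟨n, hn⟩ := mem_iUnion.1 hy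
    refine mem_biUnion (mem_Iio.2 ?_) hn
    by_contra! hNn
    refine hyr (Metric.ball_subset_ball ?_ (hball n hn))
    refine (one_div_le_one_div_of_le (by positivity) ?_).trans hN.le
    have : (N : ℝ) ≤ n := by exact_mod_cast hNn
    linarith
  obtain ⟨y, hy, hyf⟩ := isCompact_iff_ultrafilter_le_nhds.1 hfinite.isCompact f
    (le_principal_iff.2 hmem)
  refine ⟨y, mem_insert_of_mem _ ?_, hyf⟩
  obtain ⟨n, -, hn⟩ := mem_iUnion₂.1 hy
  exact mem_iUnion.2 ⟨n, hn⟩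

theorem exists_seq_separated_of_not_totallyBounded {X : Type u} [PseudoMetricSpace X] {A : Set X}
    (hA : ¬ TotallyBounded A) :
    ∃ u : ℕ → X, (∀ i, u i ∈ A) ∧ ∃ ε > 0, ∀ i j, i ≠ j → ε ≤ dist (u i) (u j) := by
  rw [Metric.totallyBounded_iff] at hA
  push Not at hA
  obtain ⟨ε, hε, hA⟩ := hA
  obtain ⟨E, hEA, hsep, hcov⟩ := exists_maximal_separated A hε
  have hinf : E.Infinite := fun hfin => hA E hfin hcov
  let e := hinf.natEmbedding
  exact ⟨fun i => e i, fun i => hEA (e i).2, ε, hε, fun i j hij =>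
    hsep _ (e i).2 _ (e j).2 fun h => hij (e.injective (Subtype.ext h))⟩

/-- At a point without compact neighborhoods, completeness makes every ball fail total boundedness,
so the `n`-th ball contains an infinite separated sequence `u n`. A function `f` is coded by the
terms of `u n` up to index `f n`; a compact set bounds the indices it meets. -/
theorem dominatingNumber_le_cof_compacts {X : Type u} [MetricSpace X] [CompleteSpace X]
    (hX : ¬ LocallyCompactSpace X) :
    lift.{u} dominatingNumber ≤ Order.cof (Compacts X) := by
  obtain ⟨x, hx⟩ : ∃ x : X, ∀ U ∈ 𝓝 x, ¬ IsCompact U := by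
    by_contra! h
    have : WeaklyLocallyCompactSpace X := ⟨fun x => by
      obtain ⟨U, hU, hc⟩ := h x
      exact ⟨U, hc, hU⟩⟩
    exact hX inferInstance
  have hseq (n : ℕ) : ∃ u : ℕ → X, (∀ i, u i ∈ Metric.ball x (1 / ((n : ℝ) + 1))) ∧
      ∃ ε > 0, ∀ i j, i ≠ j → ε ≤ dist (u i) (u j) := by
    refine exists_seq_separated_of_not_totallyBounded fun htb => ?_
    exact hx _ (mem_of_superset (Metric.ball_mem_nhds x (by positivity)) subset_closure)
      (htb.closure.isCompact_of_isClosed isClosed_closure)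
  choose u hball ε hε hsep using hseq
  have hfin (K : Compacts X) (n : ℕ) : (u n ⁻¹' K).Finite :=
    finite_preimage_of_separated K.isCompact (hε n) (hsep n)
  choose b hb using fun K n => (hfin K n).bddAbove
  have := lift_cof_le_of_tukey
    (fun f : ℕ → ℕ => (⟨_, isCompact_insert_iUnion_of_finite (x := x)
      (F := fun n => u n '' Iic (f n)) (fun n => (finite_Iic _).image _)
      (fun n => image_subset_iff.2 fun i _ => hball n i)⟩ : Compacts X)) b
    (fun f K hfK n => hb K n
      (SetLike.coe_subset_coe.2 hfK (mem_insert_of_mem _ (mem_iUnion.2 ⟨n, mem_image_of_mem _ self_mem_Iic⟩))))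
  simpa [dominatingNumber] using this

/-- Near a point of uncountable local density, the cardinal `localDensity x` is exhausted by
sets which embed as separated sets into arbitrarily small balls. -/
theorem exists_separated_embeddings {X : Type u} [MetricSpace X] {x : X}
    (hx : ℵ₀ < localDensity x) :
    ∃ T : ℕ → Set (localDensity x).out, (∀ a N, ∃ n ≥ N, a ∈ T n) ∧
      ∀ n, ∃ j : T n → X, (∀ a, j a ∈ Metric.ball x (1 / ((n : ℝ) + 1))) ∧
        ∃ ε > 0, ∀ a b, a ≠ b → ε ≤ dist (j a) (j b) := by
  choose E hE hsep hcov using fun n m : ℕ => exists_maximal_separated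
    (Metric.ball x (1 / ((n : ℝ) + 1))) (ε := 1 / ((m : ℝ) + 1)) (by positivity)
  have hunion (n : ℕ) : localDensity x ≤ #(⋃ m, E n m) := by
    refine localDensity_le_of_subset_closure (r := 1 / ((n : ℝ) + 1)) (by positivity)
      (iUnion_subset (hE n)) fun y hy => ?_
    refine Metric.mem_closure_iff.2 fun r hr => ?_
    obtain ⟨m, hm⟩ := exists_nat_one_div_lt hr
    obtain ⟨e, he, hye⟩ := mem_iUnion₂.1 (hcov n m hy)
    exact ⟨e, mem_iUnion.2 ⟨m, he⟩, (Metric.mem_ball.1 hye).trans hm⟩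
  have hembed (n m : ℕ) (T : Set (localDensity x).out) (hT : #T ≤ #(E n m)) :
      ∃ j : T → X, (∀ a, j a ∈ Metric.ball x (1 / ((n : ℝ) + 1))) ∧
        ∃ ε > 0, ∀ a b, a ≠ b → ε ≤ dist (j a) (j b) := by
    obtain ⟨j⟩ := (Cardinal.le_def _ _).1 hT
    exact ⟨fun a => j a, fun a => hE n m (j a).2, 1 / ((m : ℝ) + 1), by positivity, fun a b hab =>
      hsep n m _ (j a).2 _ (j b).2 fun h => hab (j.injective (Subtype.ext h))⟩
  by_cases hall : ∀ n, ∃ m, localDensity x ≤ #(E n m)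
  · refine ⟨fun _ => Set.univ, fun a N => ⟨N, le_rfl, mem_univ a⟩, fun n => ?_⟩
    obtain ⟨m, hm⟩ := hall n
    exact hembed n m _ (by simpa using hm)
  push Not at hall
  obtain ⟨n₀, hn₀⟩ := hall
  obtain ⟨i⟩ : Nonempty ((localDensity x).out ↪ (⋃ m, E n₀ m : Set X)) := by
    rw [← Cardinal.le_def, mk_out]
    exact hunion n₀
  -- In the ball `n₀` every net is smaller than `localDensity x`, but their union is not. Unpairing
  -- repeats each net at arbitrarily late indices.
  refine ⟨fun n => {a | (i a : X) ∈ E n₀ n.unpair.1}, fun a N => ?_, fun n => ?_⟩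
  · obtain ⟨m, hm⟩ := mem_iUnion.1 (i a).2
    exact ⟨Nat.pair m N, Nat.right_le_pair m N, by simpa using hm⟩
  -- Otherwise the union of the nets in the `n`-th ball has size at most `ℵ₀` times that of a small
  -- net, which is below the uncountable `localDensity x`.
  · obtain ⟨m, hm⟩ : ∃ m, #(E n₀ n.unpair.1) ≤ #(E n m) := by
      by_contra! hlt
      refine (hunion n).not_gt ?_
      have h1 := mk_iUnion_le_lift (E n)
      simp only [lift_uzero, mk_nat, lift_aleph0] at h1
      refine h1.trans_lt (mul_lt_of_lt hx.le hx ((ciSup_le' fun m => ?_).trans_lt (hn₀ n.unpair.1)))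
      exact (hlt m).le
    refine hembed n m _ (le_trans ?_ hm)
    exact mk_le_of_injective (f := fun a : {a | (i a : X) ∈ E n₀ n.unpair.1} =>
      (⟨i a, a.2⟩ : E n₀ n.unpair.1)) fun a b hab =>
        Subtype.ext (i.injective (Subtype.ext (Subtype.mk.inj hab)))

/-! ### Countably infinite subsets of a cardinal -/

theorem mk_eq_aleph0_of_countable {α : Type u} {s : Set α} (hs : s.Countable) (hs' : s.Infinite) :
    #s = ℵ₀ :=
  le_antisymm (le_aleph0_iff_set_countable.2 hs) (infinite_iff.1 hs'.to_subtype)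

theorem countable_of_mk_eq_aleph0 {κ : Cardinal.{u}} (s : CountablyInfiniteSubsets κ) :
    s.1.Countable :=
  le_aleph0_iff_set_countable.1 s.2.le

theorem nonempty_of_mk_eq_aleph0 {κ : Cardinal.{u}} (s : CountablyInfiniteSubsets κ) :
    s.1.Nonempty := by
  rw [← Set.nonempty_coe_sort, ← mk_ne_zero_iff, s.2]
  exact aleph0_ne_zero

/-- A sequence enumerating a countably infinite subset. -/
theorem exists_range_eq {κ : Cardinal.{u}} (s : CountablyInfiniteSubsets κ) :
    ∃ a : ℕ → κ.out, s.1 = range a :=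
  (countable_of_mk_eq_aleph0 s).exists_eq_range (nonempty_of_mk_eq_aleph0 s)

/-- Every countable subset of an infinite cardinal is contained in a countably infinite one. -/
theorem exists_countablyInfinite_superset {κ : Cardinal.{u}} (hκ : ℵ₀ ≤ κ) {A : Set κ.out}
    (hA : A.Countable) : ∃ s : CountablyInfiniteSubsets κ, A ⊆ s.1 := by
  have : Infinite κ.out := infinite_iff.2 (by rwa [mk_out])
  have hinf : (range (Infinite.natEmbedding κ.out)).Infinite :=
    infinite_range_of_injective (Infinite.natEmbedding κ.out).injective
  exact ⟨⟨A ∪ range (Infinite.natEmbedding κ.out), mk_eq_aleph0_of_countable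
    (hA.union (countable_range _)) (hinf.mono subset_union_right)⟩, subset_union_left⟩

theorem cof_countablyInfiniteSubsets_le_one {κ : Cardinal.{u}} (hκ : κ ≤ ℵ₀) :
    Order.cof (CountablyInfiniteSubsets κ) ≤ 1 := by
  rcases isEmpty_or_nonempty (CountablyInfiniteSubsets κ) with h | ⟨⟨s⟩⟩
  · simp
  have : Nonempty (CountablyInfiniteSubsets κ) := ⟨s⟩
  rw [Order.cof_le_one_iff]
  have hinf : s.1.Infinite := infinite_coe_iff.1 (infinite_iff.2 s.2.ge)
  refine ⟨⟨Set.univ, mk_eq_aleph0_of_countable ?_ (hinf.mono (subset_univ _))⟩,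
    fun t => subset_univ t.1⟩
  rw [← le_aleph0_iff_set_countable, mk_univ, mk_out]
  exact hκ

/-- In the uncountable case, `s = {a 0, a 1, …}` is coded by placing in the `n`-th ball the images
of those `a 0, …, a n` that lie in `T n`. Each `a i` appears, as it lies in some `T n` with `n ≥ i`;
a compact set catches only countably many indices. -/
theorem cof_countablyInfiniteSubsets_le_cof_compacts {X : Type u} [MetricSpace X]
    (hX : ¬ CompactSpace X) (x : X) :
    Order.cof (CountablyInfiniteSubsets (localDensity x)) ≤ Order.cof (Compacts X) := by
  rcases le_or_gt (localDensity x) ℵ₀ with hx | hx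
  · exact (cof_countablyInfiniteSubsets_le_one hx).trans
      (one_le_aleph0.trans (aleph0_le_cof_compacts hX))
  obtain ⟨T, hT, hj⟩ := exists_separated_embeddings hx
  choose j hball ε hε hsep using hj
  choose a ha using fun s : CountablyInfiniteSubsets (localDensity x) => exists_range_eq s
  have hcount (K : Compacts X) :
      (⋃ n, (↑) '' (j n ⁻¹' (K : Set X)) : Set (localDensity x).out).Countable :=
    countable_iUnion fun n =>
      ((finite_preimage_of_separated K.isCompact (hε n) (hsep n)).image _).countable
  choose ψ hψ using fun K : Compacts X => exists_countablyInfinite_superset hx.le (hcount K)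
  have hfin (s : CountablyInfiniteSubsets (localDensity x)) (n : ℕ) :
      (j n '' ((↑) ⁻¹' (a s '' Iic n))).Finite :=
    (((finite_Iic n).image _).preimage Subtype.val_injective.injOn).image _
  have := lift_cof_le_of_tukey
    (fun s => (⟨_, isCompact_insert_iUnion_of_finite (x := x) (hfin s)
      (fun n => image_subset_iff.2 fun t _ => hball n t)⟩ : Compacts X)) ψ ?_
  · simpa using this
  · intro s K hsK t ht
    rw [ha s] at ht
    obtain ⟨i, rfl⟩ := ht
    obtain ⟨n, hn, htn⟩ := hT (a s i) i
    refine hψ K (mem_iUnion.2 ⟨n, ⟨a s i, htn⟩, ?_, rfl⟩)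
    exact SetLike.coe_subset_coe.2 hsK (mem_insert_of_mem _ (mem_iUnion.2
      ⟨n, ⟨a s i, htn⟩, mem_image_of_mem (a s) (mem_Iic.2 hn), rfl⟩))

/-! ### Upper bounds and the two formulas -/

/-- The dominating sets are intersections over `n` of finitely many closed balls of radius
`1/(n+1)`, centered at the first `f n + 1` points of a sequence enumerating `s`: closed and totally
bounded, hence compact. The finite covers of a given `K` use countably many centers in all, caught
by some `s`, and their index bounds are dominated by some `f`. -/
theorem exists_compacts_covering_of_subset_closure {X : Type u} [MetricSpace X] [CompleteSpace X]
    {κ : Cardinal.{u}} (hκ : ℵ₀ ≤ κ) {D : Set X} (hD : #D = κ) :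
    ∃ C : Set (Compacts X),
      #C ≤ lift.{u} dominatingNumber * Order.cof (CountablyInfiniteSubsets κ) ∧
      ∀ K : Compacts X, (K : Set X) ⊆ closure D → ∃ L ∈ C, K ≤ L := by
  obtain ⟨e⟩ : Nonempty (κ.out ≃ D) := by rw [← Cardinal.eq, mk_out, hD]
  obtain ⟨Φ, hΦ, hΦcard⟩ := Order.exists_cof_eq (ℕ → ℕ)
  obtain ⟨S, hS, hScard⟩ := Order.exists_cof_eq (CountablyInfiniteSubsets κ)
  choose a ha using fun s : CountablyInfiniteSubsets κ => exists_range_eq s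
  let A (p : (ℕ → ℕ) × CountablyInfiniteSubsets κ) (n : ℕ) : Set X :=
    ⋃ i ∈ Iic (p.1 n), Metric.closedBall (e (a p.2 i) : X) (1 / (n + 1))
  have hcpt (p) : IsCompact (⋂ n, A p n) := by
    refine TotallyBounded.isCompact_of_isClosed ?_ (isClosed_iInter fun n =>
      (finite_Iic _).isClosed_biUnion fun i _ => Metric.isClosed_closedBall)
    refine Metric.totallyBounded_iff.2 fun ε hε => ?_
    obtain ⟨n, hn⟩ := exists_nat_one_div_lt hε
    refine ⟨(fun i => (e (a p.2 i) : X)) '' Iic (p.1 n), (finite_Iic _).image _, ?_⟩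
    rw [biUnion_image]
    exact (iInter_subset _ n).trans
      (iUnion₂_mono fun i _ => Metric.closedBall_subset_ball hn)
  let L (p : Φ × S) : Compacts X := ⟨_, hcpt (p.1, p.2)⟩
  refine ⟨range L, ?_, fun K hK => ?_⟩
  · have h := mk_range_le_lift (f := L)
    simpa [hΦcard, hScard, dominatingNumber] using h
  have hfin (n : ℕ) : ∃ t : Set κ.out, t.Finite ∧
      (K : Set X) ⊆ ⋃ i ∈ t, Metric.ball (e i : X) (1 / ((n : ℝ) + 1)) := by
    obtain ⟨t, ht⟩ := K.isCompact.elim_finite_subcover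
      (fun i : κ.out => Metric.ball (e i : X) (1 / ((n : ℝ) + 1))) (fun i => Metric.isOpen_ball)
      (fun y hy => by
        obtain ⟨d, hd, hyd⟩ := Metric.mem_closure_iff.1 (hK hy) (1 / ((n : ℝ) + 1)) (by positivity)
        exact mem_iUnion.2 ⟨e.symm ⟨d, hd⟩, by simpa using hyd⟩)
    exact ⟨t, t.finite_toSet, by simpa using ht⟩
  choose t ht hKt using hfin
  obtain ⟨s₀, hs₀⟩ := exists_countablyInfinite_superset hκ
    (countable_iUnion fun n => (ht n).countable)
  obtain ⟨s, hs, hs₀s⟩ := hS s₀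
  have hsub : (⋃ n, t n) ⊆ range (a s) := (ha s) ▸ hs₀.trans hs₀s
  have hbound (n : ℕ) : ∃ b, t n ⊆ a s '' Iic b := by
    obtain ⟨F, -, hF, hFt⟩ := exists_subset_image_finite_and (f := a s) (s := Set.univ)
      (p := fun u => u = t n) |>.1 ⟨t n, by simpa using (subset_iUnion t n).trans hsub, ht n, rfl⟩
    obtain ⟨b, hb⟩ := hF.bddAbove
    exact ⟨b, hFt ▸ image_mono fun i hi => hb hi⟩
  choose b hb using hbound
  obtain ⟨f, hf, hbf⟩ := hΦ b
  refine ⟨_, ⟨(⟨f, hf⟩, ⟨s, hs⟩), rfl⟩, ?_⟩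
  refine SetLike.coe_subset_coe.1 (subset_iInter fun n => (hKt n).trans ?_)
  refine iUnion₂_subset fun x hx => ?_
  obtain ⟨i, hi, rfl⟩ := hb n hx
  exact Metric.ball_subset_closedBall.trans
    (subset_biUnion_of_mem (u := fun i => Metric.closedBall (e (a s i) : X) (1 / ((n : ℝ) + 1)))
      (mem_Iic.2 ((mem_Iic.1 hi).trans (hbf n))))

/-- A bound on the cofinality of compact sets from bounds near every point. -/
theorem cof_compacts_le_of_local {X : Type u} [MetricSpace X] {μ : Cardinal.{u}} (hμ : ℵ₀ ≤ μ)
    (hd : density X ≤ μ)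
    (hloc : ∀ x : X, ∃ U ∈ 𝓝 x, ∃ C : Set (Compacts X), #C ≤ μ ∧
      ∀ K : Compacts X, (K : Set X) ⊆ U → ∃ L ∈ C, K ≤ L) :
    Order.cof (Compacts X) ≤ μ := by
  classical
  obtain ⟨D, hD, hDcard⟩ := exists_dense_mk_eq_density X
  -- Balls without a small dominating family get the default `∅`, so that a family can be chosen for
  -- every ball at once.
  have hball (p : D × ℕ) : ∃ C : Set (Compacts X), #C ≤ μ ∧
      ((∃ C' : Set (Compacts X), #C' ≤ μ ∧ ∀ K : Compacts X,
        (K : Set X) ⊆ Metric.closedBall (p.1 : X) (1 / ((p.2 : ℝ) + 1)) → ∃ L ∈ C', K ≤ L) →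
      ∀ K : Compacts X,
        (K : Set X) ⊆ Metric.closedBall (p.1 : X) (1 / ((p.2 : ℝ) + 1)) → ∃ L ∈ C, K ≤ L) := by
    by_cases h : ∃ C' : Set (Compacts X), #C' ≤ μ ∧ ∀ K : Compacts X,
        (K : Set X) ⊆ Metric.closedBall (p.1 : X) (1 / ((p.2 : ℝ) + 1)) → ∃ L ∈ C', K ≤ L
    · obtain ⟨C, hC, hC'⟩ := h
      exact ⟨C, hC, fun _ => hC'⟩
    · exact ⟨∅, by simp, fun h' => absurd h' h⟩
  choose C hCcard hC using hball
  let J := Σ p : D × ℕ, C p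
  have hJ : #J ≤ μ := by
    rw [mk_sigma]
    refine (sum_le_mk_mul_iSup _).trans (mul_le_of_le hμ ?_ (ciSup_le' hCcard))
    simpa [hDcard] using mul_le_of_le hμ hd hμ
  have hFJ : #(Finset J) ≤ μ := by
    rcases finite_or_infinite J with h | h
    · exact (lt_aleph0_of_finite (Finset J)).le.trans hμ
    · rwa [mk_finset_of_infinite]
  refine (Order.cof_le (s := range fun F : Finset J => F.sup fun q => (q.2 : Compacts X))
    fun K => ?_).trans (mk_range_le.trans hFJ)
  -- The doubled `K` gives the form `s ∩ K` that compactness induction on `s` needs.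
  have hind : ∃ F : Finset J, (K : Set X) ∩ K ⊆ (F.sup fun q => (q.2 : Compacts X) : Compacts X) := by
    refine K.isCompact.induction_on (p := fun s => ∃ F : Finset J,
      s ∩ K ⊆ (F.sup fun q => (q.2 : Compacts X) : Compacts X)) ⟨∅, by simp⟩
      (fun s t hst ⟨F, hF⟩ => ⟨F, (inter_subset_inter_left _ hst).trans hF⟩)
      (fun s t ⟨F, hF⟩ ⟨F', hF'⟩ => ⟨F ∪ F', ?_⟩) fun y _ => ?_
    · rw [Finset.sup_union, union_inter_distrib_right, Compacts.coe_sup]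
      exact union_subset_union hF hF'
    obtain ⟨U, hU, C', hC'card, hC'⟩ := hloc y
    obtain ⟨r, hr, hrU⟩ := Metric.mem_nhds_iff.1 hU
    obtain ⟨n, hn⟩ := exists_nat_one_div_lt (half_pos hr)
    have hpos : (0 : ℝ) < 1 / ((n : ℝ) + 1) := by positivity
    obtain ⟨d, hd, hyd⟩ := Metric.mem_closure_iff.1 (hD y) _ hpos
    have hsub : Metric.closedBall d (1 / ((n : ℝ) + 1)) ⊆ U := fun z hz => hrU <| by
      rw [Metric.mem_closedBall] at hz
      rw [Metric.mem_ball]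
      linarith [dist_triangle z d y, dist_comm y d]
    refine ⟨Metric.closedBall d (1 / ((n : ℝ) + 1)), mem_nhdsWithin_of_mem_nhds ?_, ?_⟩
    · exact mem_of_superset (Metric.isOpen_ball.mem_nhds hyd) Metric.ball_subset_closedBall
    obtain ⟨L, hL, hKL⟩ := hC (⟨d, hd⟩, n) ⟨C', hC'card, fun K hK => hC' K (hK.trans hsub)⟩
      ⟨Metric.closedBall d (1 / ((n : ℝ) + 1)) ∩ K,
        K.isCompact.inter_left Metric.isClosed_closedBall⟩ inter_subset_left
    exact ⟨{⟨(⟨d, hd⟩, n), ⟨L, hL⟩⟩}, by simpa using SetLike.coe_subset_coe.2 hKL⟩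
  obtain ⟨F, hF⟩ := hind
  rw [inter_self] at hF
  exact ⟨_, ⟨F, rfl⟩, hF⟩

theorem cof_compacts_eq_density {X : Type u} [MetricSpace X] [LocallyCompactSpace X]
    (hX : ¬ CompactSpace X) : Order.cof (Compacts X) = density X := by
  refine le_antisymm (cof_compacts_le_of_local (aleph0_le_density hX) le_rfl fun x => ?_)
    (density_le_cof_compacts hX)
  obtain ⟨U, hU, hx⟩ := exists_compact_mem_nhds x
  exact ⟨U, hx, {⟨U, hU⟩}, by simpa using one_le_aleph0.trans (aleph0_le_density hX),
    fun K hK => ⟨_, rfl, hK⟩⟩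

theorem exists_aleph0_le_localDensity {X : Type u} [MetricSpace X]
    (hX : ¬ LocallyCompactSpace X) : ∃ x : X, ℵ₀ ≤ localDensity x := by
  by_contra! h
  have : WeaklyLocallyCompactSpace X := ⟨fun x => by
    obtain ⟨U, hU, D, hUD, hD⟩ := exists_nhds_subset_closure_mk_eq_localDensity x
    have hfin : D.Finite := lt_aleph0_iff_set_finite.1 (hD ▸ h x)
    exact ⟨D, hfin.isCompact, mem_of_superset hU (hfin.isClosed.closure_eq ▸ hUD)⟩⟩
  exact hX inferInstance

theorem cof_compacts_eq_mul {X : Type u} [MetricSpace X] [CompleteSpace X]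
    (hX : ¬ LocallyCompactSpace X) :
    Order.cof (Compacts X) = density X * lift.{u} dominatingNumber *
      ⨆ x : X, Order.cof (CountablyInfiniteSubsets (localDensity x)) := by
  have hX' : ¬ CompactSpace X := fun _ => hX inferInstance
  have hinf := aleph0_le_cof_compacts hX'
  refine le_antisymm ?_ (mul_le_of_le hinf (mul_le_of_le hinf (density_le_cof_compacts hX')
    (dominatingNumber_le_cof_compacts hX))
    (ciSup_le' (cof_countablyInfiniteSubsets_le_cof_compacts hX')))
  set τ := ⨆ x : X, Order.cof (CountablyInfiniteSubsets (localDensity x)) with hτ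
  have hle (x : X) : Order.cof (CountablyInfiniteSubsets (localDensity x)) ≤ τ :=
    le_ciSup bddAbove_of_small x
  -- Points of finite local density contribute `0` to the supremum; a point of infinite local
  -- density keeps the product from vanishing.
  have hτ1 : 1 ≤ τ := by
    obtain ⟨x, hx⟩ := exists_aleph0_le_localDensity hX
    obtain ⟨s, -⟩ := exists_countablyInfinite_superset hx countable_empty
    have : Nonempty (CountablyInfiniteSubsets (localDensity x)) := ⟨s⟩
    exact (Cardinal.one_le_iff_ne_zero.2 Order.cof_ne_zero).trans (hle x)
  have hdom : 1 ≤ lift.{u} dominatingNumber := by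
    rw [Cardinal.one_le_iff_ne_zero, Ne, lift_eq_zero]
    exact Order.cof_ne_zero
  have hd := aleph0_le_density hX'
  have hdμ : density X ≤ density X * lift.{u} dominatingNumber * τ := by
    calc density X = density X * 1 * 1 := by simp
      _ ≤ _ := by gcongr
  refine cof_compacts_le_of_local (hd.trans hdμ) hdμ fun x => ?_
  obtain ⟨U, hU, D, hUD, hD⟩ := exists_nhds_subset_closure_mk_eq_localDensity x
  refine ⟨U, hU, ?_⟩
  rcases lt_or_ge (localDensity x) ℵ₀ with hx | hx
  -- Here the neighborhood lies in the finite set `D`, which alone dominates.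
  · have hfin : D.Finite := lt_aleph0_iff_set_finite.1 (hD ▸ hx)
    exact ⟨{⟨D, hfin.isCompact⟩}, by simpa using one_le_aleph0.trans (hd.trans hdμ),
      fun K hK => ⟨_, rfl, (hK.trans hUD).trans_eq hfin.isClosed.closure_eq⟩⟩
  · obtain ⟨C, hC, hKC⟩ := exists_compacts_covering_of_subset_closure hx hD
    refine ⟨C, hC.trans ?_, fun K hK => hKC K (hK.trans hUD)⟩
    calc _ = 1 * lift.{u} dominatingNumber *
          Order.cof (CountablyInfiniteSubsets (localDensity x)) := by rw [one_mul]
      _ ≤ _ := by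
        gcongr
        · exact one_le_aleph0.trans hd
        · exact hle x

end CompactOpenWeight

theorem mainTheorem7 (X : Type u) [MetricSpace X] [CompleteSpace X]
    (hdiscrete : ¬ DiscreteTopology X) (hcompact : ¬ CompactSpace X)
    (G : Type v) [Group G] [TopologicalSpace G] [IsTopologicalGroup G]
    [SecondCountableTopology G] (harc : CompactOpenWeight.ContainsArc G) :
    (LocallyCompactSpace X →
      CompactOpenWeight.weight C(X, G) =
        Cardinal.lift.{v} (CompactOpenWeight.density X)) ∧
    (¬ LocallyCompactSpace X →
      CompactOpenWeight.weight C(X, G) =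
        Cardinal.lift.{v} (CompactOpenWeight.density X *
          Cardinal.lift.{u} CompactOpenWeight.dominatingNumber *
          ⨆ x : X, Order.cof (CompactOpenWeight.CountablyInfiniteSubsets
            (CompactOpenWeight.localDensity x)))) := by
  rw [CompactOpenWeight.weight_continuousMap_eq hcompact harc]
  exact ⟨fun _ => by rw [CompactOpenWeight.cof_compacts_eq_density hcompact],
    fun h => by rw [CompactOpenWeight.cof_compacts_eq_mul h]⟩
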